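/- All groups are finite and $\mathbb{N}=\{1,2,3,\dots\}$. For a group $G$, $m\in\mathbb{N}$ and $u,g\in G$ put $G_m(u,g)=\{a\in G : a^m=(au)^m=g\}$. The group $G$ is called $FSZ_m$ if $|G_m(u,g)|=|G_m(u,g^n)|$ for all $u,g\in G$ and all $n\in\mathbb{N}$ with $\gcd(n,|G|)=1$, and it is called $FSZ_m^+$ if the centralizer $C_G(g)$ is $FSZ_m$ for every $g\in G$. For a prime $p$ and $j\in\mathbb{N}$ let $Q_{p,j}=\mathbb{Z}_{p^{j+1}}\times\mathbb{Z}_p^{p^j-1}$ be the abelian group with independent generators $a_1,\dots,a_{p^j}$, where $a_1$ has order $p^{j+1}$ and the other $a_k$ have order $p$. Let $b_{p,j}$ be the automorphism of $Q_{p,j}$ with $a_1\mapsto a_1a_2^{-1}$, $a_k\mapsto a_ka_{k+1}$ for $2\le k<p^j$, and $a_{p^j}\mapsto a_{p^j}$, and let $F(p,j)=Q_{p,j}\rtimes\langle b_{p,j}\rangle$. For a group $D$ let $D\wr_r\mathbb{Z}_p=D^p\rtimes\mathbb{Z}_p$ be the regular wreath product, where $\mathbb{Z}_p$ permutes the $p$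 factors cyclically. Theorem. For every prime $p$, the group $F(p,1)\wr_r\mathbb{Z}_p$ is $FSZ_{p^t}^+$ for all integers $t>1$. -/

import Mathlib

namespace FSZ

section Basic

variable {G : Type*} [Group G]

/-- The set `G_m(u, g) = {a ∈ G : a ^ m = (a u) ^ m = g}`. -/
def powSet (m : ℕ) (u g : G) : Set G :=
  {a | a ^ m = g ∧ (a * u) ^ m = g}

variable (G)

/-- A finite group `G` is `FSZ_m` if `|G_m(u, g)| = |G_m(u, g ^ n)|` for every positive integer `n`
coprime to `|G|` and all `u, g ∈ G`. -/
def IsFSZ [Finite G] (m : ℕ) : Prop :=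
  ∀ n : ℕ, 0 < n → Nat.Coprime n (Nat.card G) →
    ∀ u g : G, (powSet m u g).ncard = (powSet m u (g ^ n)).ncard

/-- A finite group `G` is `FSZ_m⁺` if the centralizer of every element of `G` is `FSZ_m`. -/
def IsFSZPlus [Finite G] (m : ℕ) : Prop :=
  ∀ g : G, IsFSZ (Subgroup.centralizer ({g} : Set G)) m

end Basic

section FGroup

/-- The abelian group `ℤ/p^(j+1) × (ℤ/p)^(p^j - 1)`, written additively. A pair `(x, v)` stands for
`a_1 ^ x * ∏ a_(i+2) ^ (v i)`, where `i` runs over `0, …, p^j - 2`. -/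
abbrev QAdd (p j : ℕ) : Type :=
  ZMod (p ^ (j + 1)) × (Fin (p ^ j - 1) → ZMod p)

/-- Reduction `ℤ/p^(j+1) → ℤ/p`. -/
def reduce (p j : ℕ) : ZMod (p ^ (j + 1)) →+* ZMod p :=
  ZMod.castHom (dvd_pow_self p (Nat.succ_ne_zero j)) (ZMod p)

/-- The endomorphism `b` of `QAdd p j` with `a_1 ↦ a_1 a_2⁻¹`, `a_k ↦ a_k a_(k+1)` for
`2 ≤ k < p^j`, and `a_(p^j) ↦ a_(p^j)`. In coordinates, the exponent of `a_1` is kept, that of `a_2`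
becomes `v 0 - x`, and that of `a_(i+2)` becomes `v i + v (i - 1)` for `i > 0`. -/
def bHom (p j : ℕ) : QAdd p j →+ QAdd p j where
  toFun q := (q.1, fun i =>
    if (i : ℕ) = 0 then q.2 i - reduce p j q.1
    else q.2 i + q.2 ⟨(i : ℕ) - 1, lt_of_le_of_lt (Nat.sub_le _ _) i.isLt⟩)
  map_zero' := by
    ext i
    · rfl
    · simp
  map_add' q r := by
    ext i
    · rfl
    · by_cases h : (i : ℕ) = 0 <;> simp [h] <;> ring

theorem bHom_injective (p j : ℕ) : Function.Injective (bHom p j) := by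
  rw [injective_iff_map_eq_zero]
  rintro ⟨x, v⟩ h
  have hx : x = 0 := congrArg Prod.fst h
  have hv : ∀ (k : ℕ) (hk : k < p ^ j - 1), v ⟨k, hk⟩ = 0 := by
    intro k
    induction k with
    | zero =>
      intro hk
      have h0 := congrFun (congrArg Prod.snd h) ⟨0, hk⟩
      simpa [bHom, hx] using h0
    | succ k ih =>
      intro hk
      have h1 := congrFun (congrArg Prod.snd h) ⟨k + 1, hk⟩
      simpa [bHom, ih (Nat.lt_of_succ_lt hk)] using h1
  ext i
  · exact hx
  · exact hv i i.isLt

variable (p : ℕ) [hp : Fact p.Prime] (j : ℕ)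

instance neZeroPrimePow : NeZero (p ^ (j + 1)) := ⟨pow_ne_zero _ hp.out.ne_zero⟩

/-- The group `Q_{p,j}`, written multiplicatively. -/
abbrev QGroup (p j : ℕ) : Type := Multiplicative (QAdd p j)

/-- The endomorphism `b` as an automorphism `b_{p,j}` of `Q_{p,j}`. -/
noncomputable def bAut : MulAut (QGroup p j) :=
  AddEquiv.toMultiplicative
    (AddEquiv.ofBijective (bHom p j) (Finite.injective_iff_bijective.mp (bHom_injective p j)))

/-- The group `F(p,j) = Q_{p,j} ⋊ ⟨b_{p,j}⟩`. -/
abbrev FGroup : Type :=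
  QGroup p j ⋊[(Subgroup.zpowers (bAut p j)).subtype] Subgroup.zpowers (bAut p j)

instance finiteFGroup : Finite (FGroup p j) :=
  Finite.of_equiv _ SemidirectProduct.equivProd.symm

end FGroup

end FSZ

/-! Let `φ` be the exponent of `a_1` mod `p` and `ι` the projection to `⟨b⟩` on `F(p,1)`. A `p`-th
power there is `q ^ p` or the norm of `q` under `⟨b⟩`, where `q` is the `Q`-part. Both are
homomorphisms in `q` that vanish where `φ` is trivial, so `y ^ p` depends only on `φ y` and on
whether `ι y = 1` (`pow_prime_eq`).

In the wreath product, each coordinate of `a ^ p`, for `a` outside the base group, is a product of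
all coordinates of `a`. So `a ^ p ^ 2` is controlled by three homomorphisms to groups of order `p`:
the products `X` of `φ` and `I` of `ι` over the coordinates, and the projection `Z` to the top
group; only the triviality of `I` and `Z` matters (`wreath_pow_sq_eq`).

For `n` coprime to the order, `isFSZ_of_homs` builds a bijection `θ` raising `X` to the `n`-th power
and `I`, `Z` to powers 1 or `n`, chosen so that `θ a` and `θ a * u` have the `n`-th powers of the
old `m`-th powers. The image of each centralizer under `(X, I, Z)` is large enough, or `ker X` small
enough, for `θ` to exist. -/

namespace FSZ

/-! ### Counting criterion from three homomorphisms -/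

section Criterion

/-- An injective self-map of the codomain that preserves the range of a homomorphism lifts to a
bijection of the (finite) domain. -/
theorem exists_bijective_lift {C M : Type*} [Group C] [Finite C] [Group M] (f : C →* M)
    (τ : M → M) (hτ : Function.Injective τ) (h : ∀ a, ∃ c, f c = τ (f a)) :
    ∃ θ : C → C, Function.Bijective θ ∧ ∀ a, f (θ a) = τ (f a) := by
  -- The multiplier depends only on `f a`, so the lift is a translation on each fibre, hence
  -- injective.
  have h' : ∀ v : M, ∃ c : C, v ∈ Set.range f → f c = τ v * v⁻¹ := by
    intro v
    by_cases hv : v ∈ Set.range f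
    · obtain ⟨a, rfl⟩ := hv
      obtain ⟨c, hc⟩ := h a
      exact ⟨c * a⁻¹, fun _ => by simp [hc]⟩
    · exact ⟨1, fun h => absurd h hv⟩
  choose s hs using h'
  have hf : ∀ a, f (s (f a) * a) = τ (f a) := fun a => by simp [hs (f a) ⟨a, rfl⟩]
  refine ⟨fun a => s (f a) * a, Finite.injective_iff_bijective.mp fun a b hab => ?_, hf⟩
  have hfab : f a = f b := hτ (by rw [← hf, ← hf]; exact congrArg f hab)
  simpa [hfab] using hab

theorem exists_pow_eq_of_card_prime {B : Type*} [Group B] {p : ℕ} [Fact p.Prime]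
    (hB : Nat.card B = p) {b : B} (hb : b ≠ 1) (c : B) : ∃ k : ℕ, b ^ k = c :=
  Submonoid.mem_powers_iff _ _ |>.mp (mem_powers_of_prime_card hB hb)

variable {C A B D : Type*} [Group C] [Finite C] [CommGroup A] [CommGroup B] [CommGroup D]

theorem pow_injective_of_card_prime {p n : ℕ} (hB : Nat.card B = p)
    (hn : n.Coprime p) : Function.Injective (fun b : B => b ^ n) :=
  (powCoprime (G := B) (n := n) (by rw [hB]; exact hn.symm)).injective

/-- A criterion for `FSZ_m` in terms of three homomorphisms to groups of order `p` which control
the `m`-th powers. -/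
theorem isFSZ_of_homs {p m : ℕ} [Fact p.Prime] (hA : Nat.card A = p) (hB : Nat.card B = p)
    (hD : Nat.card D = p) (X : C →* A) (I : C →* B) (Z : C →* D)
    (hpow : ∀ (n : ℕ) (a b : C), X b = X a ^ n → (I b = 1 ↔ I a = 1) → (Z b = 1 ↔ Z a = 1) →
      b ^ m = (a ^ m) ^ n)
    (hX : ∀ a b : C, a ^ m = b ^ m → a ^ m ≠ 1 → X a = X b)
    (hker : ∀ a : C, a ^ m ≠ 1 → (∃ w, X w = 1 ∧ I w = 1 ∧ Z w ≠ 1) ∨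
      ∀ u, X u = 1 → I u = 1 ∧ Z u = 1) :
    IsFSZ C m := by
  intro n hn0 hn u g
  have hpinj : Function.Injective (fun c : C => c ^ n) := (powCoprime hn.symm).injective
  -- If no `a` has `a ^ m = (a * u) ^ m ≠ 1`, both sets are empty for `g ≠ 1`.
  by_cases hempty : ∀ a : C, a ^ m = 1 ∨ (a * u) ^ m ≠ a ^ m
  · rcases eq_or_ne g 1 with rfl | hg
    · simp
    · have hgn : g ^ n ≠ 1 := fun h => hg (hpinj (by simpa using h))
      have key : ∀ x : C, x ≠ 1 → powSet m u x = ∅ := by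
        intro x hx
        ext a
        simp only [powSet, Set.mem_ofPred_eq, Set.mem_empty_iff_false, iff_false, not_and]
        intro h1 h2
        rcases hempty a with h | h
        · exact hx (h1 ▸ h)
        · exact h (h2.trans h1.symm)
      rw [key g hg, key _ hgn]
  push Not at hempty
  obtain ⟨a₀, ha₀, hau₀⟩ := hempty
  have hXu : X u = 1 := by
    have := hX (a₀ * u) a₀ hau₀ (hau₀ ▸ ha₀)
    simpa using this
  have hXa₀ : X a₀ ≠ 1 := by
    intro h
    -- Exponent 0 shows that `X a = 1` forces `a ^ m = 1`.
    have := hpow 0 a₀ a₀ (by simpa using h) Iff.rfl Iff.rfl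
    exact ha₀ (by simpa using this)
  have hnp : n.Coprime p := by
    refine Nat.Coprime.coprime_dvd_right ?_ hn
    have h1 := X.range.card_subgroup_dvd_card
    rw [hA, Nat.dvd_prime Fact.out] at h1
    rcases h1 with h1 | h1
    · rw [Subgroup.card_eq_one] at h1
      exact absurd (Subgroup.mem_bot.mp (h1 ▸ ⟨a₀, rfl⟩ : X a₀ ∈ (⊥ : Subgroup A))) hXa₀
    · exact h1 ▸ Subgroup.card_range_dvd X
  obtain ⟨k, rfl⟩ : ∃ k, n = k + 1 := ⟨n - 1, by omega⟩
  -- Exponent 1 on `I` keeps `I (θ a * u) = I (a * u)`; exponent `n` is harmless when `I u = 1`. The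
  -- same holds for `Z`. To lift, correct `a ^ n` by powers of `w` to adjust `Z`, and of `u` to
  -- adjust `I` when `I u ≠ 1`.
  obtain ⟨α, β, hα, hβ, hαu, hβu, hlift⟩ : ∃ α β : ℕ, (α = 1 ∨ α = k + 1) ∧ (β = 1 ∨ β = k + 1) ∧
      (α = 1 ∨ I u = 1) ∧ (β = 1 ∨ Z u = 1) ∧
      ∀ a : C, ∃ c : C, X c = X a ^ (k + 1) ∧ I c = I a ^ α ∧ Z c = Z a ^ β := by
    rcases hker a₀ ha₀ with ⟨w, hw1, hw2, hw3⟩ | h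
    · by_cases hIu : I u = 1
      · refine ⟨k + 1, 1, Or.inr rfl, Or.inl rfl, Or.inr hIu, Or.inl rfl, fun a => ?_⟩
        obtain ⟨j, hj⟩ := exists_pow_eq_of_card_prime hD hw3 (Z a * (Z a ^ (k + 1))⁻¹)
        exact ⟨a ^ (k + 1) * w ^ j, by simp [hw1], by simp [hw2], by simp [hj]⟩
      · refine ⟨1, 1, Or.inl rfl, Or.inl rfl, Or.inl rfl, Or.inl rfl, fun a => ?_⟩
        obtain ⟨i, hi⟩ := exists_pow_eq_of_card_prime hB hIu (I a * (I a ^ (k + 1))⁻¹)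
        obtain ⟨j, hj⟩ := exists_pow_eq_of_card_prime hD hw3
          (Z a * (Z a ^ (k + 1) * Z u ^ i)⁻¹)
        refine ⟨a ^ (k + 1) * u ^ i * w ^ j, by simp [hw1, hXu], by simp [hw2, hi], ?_⟩
        simp only [map_mul, map_pow, hj]
        rw [mul_comm, inv_mul_cancel_right, pow_one]
    · exact ⟨k + 1, k + 1, Or.inr rfl, Or.inr rfl, Or.inr (h u hXu).1, Or.inr (h u hXu).2,
        fun a => ⟨a ^ (k + 1), by simp, by simp, by simp⟩⟩
  have hcop : ∀ γ, (γ = 1 ∨ γ = k + 1) → γ.Coprime p := by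
    rintro γ (rfl | rfl)
    · exact Nat.coprime_one_left p
    · exact hnp
  have hαi := pow_injective_of_card_prime hB (hcop α hα)
  have hβi := pow_injective_of_card_prime hD (hcop β hβ)
  obtain ⟨θ, hθ, hfθ⟩ := exists_bijective_lift (X.prod (I.prod Z))
    (fun v => (v.1 ^ (k + 1), v.2.1 ^ α, v.2.2 ^ β))
    (by
      rintro ⟨x, i, z⟩ ⟨x', i', z'⟩ h
      simp only [Prod.mk.injEq] at h ⊢
      exact ⟨pow_injective_of_card_prime hA hnp h.1, hαi h.2.1, hβi h.2.2⟩)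
    (fun a => by
      obtain ⟨c, h1, h2, h3⟩ := hlift a
      exact ⟨c, by simp [h1, h2, h3]⟩)
  have hθX : ∀ a, X (θ a) = X a ^ (k + 1) := fun a => congrArg Prod.fst (hfθ a)
  have hθI : ∀ a, I (θ a) = I a ^ α := fun a => congrArg (fun v => v.2.1) (hfθ a)
  have hθZ : ∀ a, Z (θ a) = Z a ^ β := fun a => congrArg (fun v => v.2.2) (hfθ a)
  have hIone : ∀ x : B, x ^ α = 1 ↔ x = 1 := fun x =>
    ⟨fun h => hαi (by simpa using h), fun h => by simp [h]⟩
  have hZone : ∀ x : D, x ^ β = 1 ↔ x = 1 := fun x =>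
    ⟨fun h => hβi (by simpa using h), fun h => by simp [h]⟩
  have h1 : ∀ a, θ a ^ m = (a ^ m) ^ (k + 1) := fun a =>
    hpow _ _ _ (hθX a) (by rw [hθI, hIone]) (by rw [hθZ, hZone])
  have h2 : ∀ a, (θ a * u) ^ m = ((a * u) ^ m) ^ (k + 1) := fun a => by
    refine hpow _ _ _ (by simp [hθX, hXu]) ?_ ?_
    · rcases hαu with rfl | h
      · simp [hθI]
      · simp [hθI, h, hIone]
    · rcases hβu with rfl | h
      · simp [hθZ]
      · simp [hθZ, h, hZone]
  have himg : θ '' powSet m u g = powSet m u (g ^ (k + 1)) := by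
    ext c
    obtain ⟨a, rfl⟩ := hθ.2 c
    rw [hθ.1.mem_set_image]
    simp only [powSet, Set.mem_ofPred_eq, h1, h2]
    exact and_congr hpinj.eq_iff.symm hpinj.eq_iff.symm
  rw [← himg, Set.ncard_image_of_injective _ hθ.1]

end Criterion

theorem prod_range_pow_of_card_prime {Z M : Type*} [Group Z] [Fintype Z] [CommMonoid M] {p : ℕ}
    [Fact p.Prime] (hZ : Nat.card Z = p) {z : Z} (hz : z ≠ 1) (f : Z → M) :
    ∏ i ∈ Finset.range p, f (z ^ i) = ∏ x, f x := by
  have ho : orderOf z = p := by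
    rw [← hZ, ← Nat.card_zpowers, zpowers_eq_top_of_prime_card hZ hz, Subgroup.card_top]
  refine Finset.prod_nbij (fun i => z ^ i) (by simp) ?_ ?_ (by simp)
  · intro i hi j hj h
    refine pow_injOn_Iio_orderOf ?_ ?_ h
    · simpa [ho] using hi
    · simpa [ho] using hj
  · intro x _
    obtain ⟨k, rfl⟩ := exists_pow_eq_of_card_prime hZ hz x
    refine ⟨k % p, ?_, ?_⟩
    · simpa using Nat.mod_lt _ (Fact.out : p.Prime).pos
    · simp [← ho]

theorem semidirectProduct_pow_right {N H : Type*} [CommGroup N] [Group H] {φ : H →* MulAut N}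
    (y : N ⋊[φ] H) (k : ℕ) : (y ^ k).right = y.right ^ k :=
  map_pow SemidirectProduct.rightHom y k

theorem semidirectProduct_pow_left {N H : Type*} [CommGroup N] [Group H] {φ : H →* MulAut N}
    (y : N ⋊[φ] H) (k : ℕ) : (y ^ k).left = ∏ i ∈ Finset.range k, φ (y.right ^ i) y.left := by
  induction k with
  | zero => simp
  | succ k ih =>
    rw [pow_succ, SemidirectProduct.mul_left, semidirectProduct_pow_right, ih,
      Finset.prod_range_succ]

/-! ### The norm of `⟨b⟩` and the order of `b` -/

section Norm

variable (p j : ℕ)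

/-- The shift `v ↦ (0, v 0, v 1, …)`. -/
def shift : Module.End (ZMod p) (Fin (p ^ j - 1) → ZMod p) where
  toFun v i := if (i : ℕ) = 0 then 0 else v ⟨(i : ℕ) - 1, lt_of_le_of_lt (Nat.sub_le _ _) i.isLt⟩
  map_add' v w := by
    ext i
    by_cases h : (i : ℕ) = 0 <;> simp [h]
  map_smul' c v := by
    ext i
    by_cases h : (i : ℕ) = 0 <;> simp [h]

theorem shift_pow_apply (k : ℕ) (v : Fin (p ^ j - 1) → ZMod p) (i : Fin (p ^ j - 1))
    (hi : (i : ℕ) < k) : (shift p j ^ k) v i = 0 := by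
  induction k generalizing i with
  | zero => omega
  | succ k ih =>
    rw [pow_succ', Module.End.mul_apply]
    by_cases h : (i : ℕ) = 0
    · simp [shift, h]
    · simpa [shift, h] using ih _ (by simp; omega)

theorem bHom_zero_left (v : Fin (p ^ j - 1) → ZMod p) :
    bHom p j (0, v) = (0, (1 + shift p j) v) := by
  ext i
  · rfl
  · by_cases h : (i : ℕ) = 0 <;> simp [bHom, shift, h]

theorem bHom_iterate_zero_left (k : ℕ) (v : Fin (p ^ j - 1) → ZMod p) :
    (bHom p j)^[k] (0, v) = (0, ((1 + shift p j) ^ k) v) := by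
  induction k with
  | zero => rfl
  | succ k ih =>
    rw [Function.iterate_succ_apply', ih, bHom_zero_left, pow_succ' (1 + shift p j)]
    rfl

theorem bHom_iterate_fst (k : ℕ) (q : QAdd p j) : ((bHom p j)^[k] q).1 = q.1 := by
  induction k with
  | zero => rfl
  | succ k ih => rw [Function.iterate_succ_apply']; exact ih

theorem bHom_zero_right (x : ZMod (p ^ (j + 1))) (hx : reduce p j x = 0) :
    bHom p j (x, 0) = (x, 0) := by
  ext i
  · rfl
  · by_cases h : (i : ℕ) = 0 <;> simp [bHom, hx]

variable [Fact p.Prime]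

-- In characteristic `p`, `X ^ p - 1 = (X - 1) ^ p`; cancel one factor `X - 1` and evaluate at `T`.
open Polynomial in
theorem geom_sum_eq_sub_one_pow {R : Type*} [Ring R] [Algebra (ZMod p) R] (T : R) :
    ∑ i ∈ Finset.range p, T ^ i = (T - 1) ^ (p - 1) := by
  have h : (∑ i ∈ Finset.range p, X ^ i : (ZMod p)[X]) = (X - 1) ^ (p - 1) := by
    have h0 : (X - 1 : (ZMod p)[X]) ≠ 0 := X_sub_C_ne_zero 1
    refine mul_right_cancel₀ h0 ?_
    rw [geom_sum_mul, ← pow_succ, Nat.sub_add_cancel (Fact.out : p.Prime).one_le, sub_pow_char,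
      one_pow]
  simpa using congrArg (aeval T) h

theorem natCast_mul_eq_zero_iff (x : ZMod (p ^ (1 + 1))) :
    (p : ZMod (p ^ (1 + 1))) * x = 0 ↔ reduce p 1 x = 0 := by
  have hp : 0 < p := (Fact.out : p.Prime).pos
  obtain ⟨k, rfl⟩ := ZMod.natCast_zmod_surjective x
  rw [map_natCast, ZMod.natCast_eq_zero_iff, ← Nat.cast_mul, ZMod.natCast_eq_zero_iff, pow_succ,
    pow_one, Nat.mul_dvd_mul_iff_left hp]

theorem nsmul_eq_zero_of_reduce_eq_zero (q : QAdd p 1) (hq : reduce p 1 q.1 = 0) : p • q = 0 := by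
  ext i
  · simpa using (natCast_mul_eq_zero_iff p q.1).mpr hq
  · simp

theorem sum_bHom_iterate_eq_zero (q : QAdd p 1) (hq : reduce p 1 q.1 = 0) :
    ∑ i ∈ Finset.range p, (bHom p 1)^[i] q = 0 := by
  obtain ⟨x, v⟩ := q
  have h1 : ∑ i ∈ Finset.range p, (bHom p 1)^[i] (x, 0) = 0 := by
    rw [Finset.sum_congr rfl fun i _ => Function.iterate_fixed (bHom_zero_right p 1 x hq) i]
    rw [Finset.sum_const, Finset.card_range]
    exact nsmul_eq_zero_of_reduce_eq_zero p _ hq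
  have h2 : ∑ i ∈ Finset.range p, (bHom p 1)^[i] (0, v) = 0 := by
    simp only [bHom_iterate_zero_left]
    have h3 := geom_sum_eq_sub_one_pow p (1 + shift p 1)
    have h4 : ∑ i ∈ Finset.range p, ((1 + shift p 1) ^ i) v = 0 := by
      rw [← LinearMap.sum_apply, h3, add_sub_cancel_left]
      ext i
      -- There are exactly `p - 1` coordinates, so the `(p - 1)`-st power of the shift is zero.
      exact shift_pow_apply p 1 _ v i (lt_of_lt_of_eq i.isLt (by rw [pow_one]))
    ext i
    · simp [Prod.fst_sum]
    · simpa [Prod.snd_sum] using congrFun h4 i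
  have hxv : ((x, v) : QAdd p 1) = (x, 0) + (0, v) := by simp
  simp only [hxv, iterate_map_add, Finset.sum_add_distrib, h1, h2, add_zero]

/-- The norm of `b q - q` telescopes to `b^p q - q`, and it vanishes because `b` fixes the first
coordinate. -/
theorem bHom_iterate_prime (q : QAdd p 1) : (bHom p 1)^[p] q = q := by
  have h1 := sum_bHom_iterate_eq_zero p (bHom p 1 q - q) (by simp [bHom])
  simp only [iterate_map_sub, ← Function.iterate_succ_apply] at h1
  rw [Finset.sum_range_sub (fun i => (bHom p 1)^[i] q)] at h1
  exact sub_eq_zero.mp h1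

theorem bAut_pow_apply (k : ℕ) (q : QGroup p j) :
    (bAut p j ^ k) q = Multiplicative.ofAdd ((bHom p j)^[k] q.toAdd) := by
  induction k with
  | zero => rfl
  | succ k ih => rw [pow_succ' (bAut p j), MulAut.mul_apply, ih, Function.iterate_succ_apply']; rfl

theorem orderOf_bAut : orderOf (bAut p 1) = p := by
  refine orderOf_eq_prime ?_ ?_
  · ext1 q
    rw [bAut_pow_apply, bHom_iterate_prime]
    rfl
  · intro h
    have hp : 0 < p ^ 1 - 1 := by
      have := (Fact.out : p.Prime).two_le
      rw [pow_one]
      omega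
    have h1 : bHom p 1 (1, 0) = (1, 0) :=
      congrArg Multiplicative.toAdd (DFunLike.congr_fun h (Multiplicative.ofAdd (1, 0)))
    have h2 := congrFun (congrArg Prod.snd h1) ⟨0, hp⟩
    simp [bHom] at h2

theorem card_zpowers_bAut : Nat.card (Subgroup.zpowers (bAut p 1)) = p := by
  rw [Nat.card_zpowers, orderOf_bAut]

end Norm

/-! ### Powers in `F(p,1)` -/

section Power

variable (p : ℕ) [Fact p.Prime]

theorem zpowers_bAut_apply_fst (c : Subgroup.zpowers (bAut p 1)) (q : QGroup p 1) :
    ((c : MulAut (QGroup p 1)) q).toAdd.1 = q.toAdd.1 := by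
  obtain ⟨c, hc⟩ := c
  rw [← mem_powers_iff_mem_zpowers] at hc
  obtain ⟨k, rfl⟩ := hc
  exact (congrArg (fun q : QGroup p 1 => q.toAdd.1) (bAut_pow_apply p 1 k q)).trans
    (bHom_iterate_fst p 1 k _)

/-- The exponent of `a_1`, modulo `p`. -/
def expHom : FGroup p 1 →* Multiplicative (ZMod p) where
  toFun y := Multiplicative.ofAdd (reduce p 1 y.left.toAdd.1)
  map_one' := by simp
  map_mul' y z := by
    rw [SemidirectProduct.mul_left, toAdd_mul, Prod.fst_add, Subgroup.subtype_apply,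
      zpowers_bAut_apply_fst, map_add, ofAdd_add]

/-- The norm of an element of the abelian normal subgroup with respect to `⟨b⟩`. -/
noncomputable def norm : QGroup p 1 →* QGroup p 1 where
  toFun q := ∏ i ∈ Finset.range p, (bAut p 1 ^ i) q
  map_one' := by simp
  map_mul' q r := by simp [Finset.prod_mul_distrib]

theorem norm_eq_one (q : QGroup p 1) (hq : reduce p 1 q.toAdd.1 = 0) : norm p q = 1 := by
  have h := sum_bHom_iterate_eq_zero p q.toAdd hq
  simp only [norm, MonoidHom.coe_mk, OneHom.coe_mk, bAut_pow_apply]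
  rw [← ofAdd_sum, h, ofAdd_zero]

theorem pow_eq_one_of_reduce_eq_zero (q : QGroup p 1) (hq : reduce p 1 q.toAdd.1 = 0) :
    q ^ p = 1 := by
  apply Multiplicative.toAdd.injective
  rw [toAdd_pow, toAdd_one]
  exact nsmul_eq_zero_of_reduce_eq_zero p q.toAdd hq

theorem norm_fst (q : QGroup p 1) : (norm p q).toAdd.1 = p * q.toAdd.1 := by
  simp only [norm, MonoidHom.coe_mk, OneHom.coe_mk, bAut_pow_apply]
  rw [← ofAdd_sum, toAdd_ofAdd, Prod.fst_sum]
  simp [bHom_iterate_fst]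

theorem pow_prime_of_right_eq_one (y : FGroup p 1) (hy : y.right = 1) :
    y ^ p = SemidirectProduct.inl (y.left ^ p) := by
  ext1
  · simp [semidirectProduct_pow_left, hy]
  · simp [semidirectProduct_pow_right, hy]

theorem pow_prime_of_right_ne_one (y : FGroup p 1) (hy : y.right ≠ 1) :
    y ^ p = SemidirectProduct.inl (norm p y.left) := by
  have hcard := card_zpowers_bAut p
  have hb : (⟨bAut p 1, Subgroup.mem_zpowers _⟩ : Subgroup.zpowers (bAut p 1)) ≠ 1 := by
    intro h
    have h1 : bAut p 1 = 1 := congrArg Subtype.val h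
    have h2 := orderOf_bAut p
    rw [h1, orderOf_one] at h2
    exact (Fact.out : p.Prime).one_lt.ne h2
  have : Fintype (Subgroup.zpowers (bAut p 1)) := Fintype.ofFinite _
  ext1
  · rw [semidirectProduct_pow_left, SemidirectProduct.left_inl]
    -- Powers of any nontrivial element run over all of `⟨b⟩`, so `y.right` may be replaced by `b`.
    rw [prod_range_pow_of_card_prime hcard hy
      (fun c => (Subgroup.zpowers (bAut p 1)).subtype c y.left),
      ← prod_range_pow_of_card_prime hcard hb]
    rfl
  · rw [semidirectProduct_pow_right, SemidirectProduct.right_inl]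
    exact (congrArg (y.right ^ ·) hcard.symm).trans pow_card_eq_one'

/-- The `p`-th power of an element of `F(p,1)` only depends on the exponents of `a_1` and `b`. -/
theorem pow_prime_eq (n : ℕ) (y z : FGroup p 1) (h : expHom p z = expHom p y ^ n)
    (h' : z.right = 1 ↔ y.right = 1) : z ^ p = (y ^ p) ^ n := by
  have h0 : reduce p 1 (z.left * (y.left ^ n)⁻¹).toAdd.1 = 0 := by
    have h1 : reduce p 1 z.left.toAdd.1 = n • reduce p 1 y.left.toAdd.1 := h
    simp [h1]
  have hin : ∀ q : QGroup p 1,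
      (SemidirectProduct.inl q : FGroup p 1) ^ n = SemidirectProduct.inl (q ^ n) :=
    fun q => (map_pow SemidirectProduct.inl q n).symm
  by_cases hy : y.right = 1
  · rw [pow_prime_of_right_eq_one p y hy, pow_prime_of_right_eq_one p z (h'.mpr hy), hin]
    congr 1
    have h1 : (z.left * (y.left ^ n)⁻¹) ^ p = 1 := pow_eq_one_of_reduce_eq_zero p _ h0
    rw [mul_pow, inv_pow, mul_inv_eq_one] at h1
    rw [h1, ← pow_mul, ← pow_mul, mul_comm]
  · rw [pow_prime_of_right_ne_one p y hy, pow_prime_of_right_ne_one p z (h'.not.mpr hy),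
      hin]
    congr 1
    have h1 := norm_eq_one p _ h0
    rwa [map_mul, map_inv, mul_inv_eq_one, map_pow] at h1

theorem pow_prime_left_fst (y : FGroup p 1) : (y ^ p).left.toAdd.1 = p * y.left.toAdd.1 := by
  by_cases hy : y.right = 1
  · rw [pow_prime_of_right_eq_one p y hy, SemidirectProduct.left_inl]
    simp
  · simp [pow_prime_of_right_ne_one p y hy, norm_fst]

/-- The first coordinate of `y ^ p` is `p * x` in `ℤ/p²`, which determines `x` mod `p`. -/
theorem expHom_eq_of_pow_prime_eq (y z : FGroup p 1) (h : y ^ p = z ^ p) :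
    expHom p y = expHom p z := by
  have h1 := congrArg (fun w : FGroup p 1 => w.left.toAdd.1) h
  simp only [pow_prime_left_fst] at h1
  rw [← sub_eq_zero, ← mul_sub, natCast_mul_eq_zero_iff, map_sub, sub_eq_zero] at h1
  exact congrArg Multiplicative.ofAdd h1

theorem pow_prime_eq_one (y : FGroup p 1) (h : expHom p y = 1) : y ^ p = 1 := by
  simpa using pow_prime_eq p 0 y y (by simpa using h) Iff.rfl

theorem pow_prime_sq_eq_one (y : FGroup p 1) : y ^ p ^ 2 = 1 := by
  refine (congrArg (y ^ ·) (sq p)).trans ((pow_mul y p p).trans (pow_prime_eq_one p _ ?_))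
  rw [map_pow]
  simpa using pow_card_eq_one' (x := expHom p y)

end Power

/-! ### Powers in the wreath product -/

section Wreath

variable {D Q A B : Type*} [Group D] [Group Q] [CommGroup A] [CommGroup B]

theorem wreath_pow_right (a : D ≀ᵣ Q) (k : ℕ) : (a ^ k).right = a.right ^ k :=
  map_pow RegularWreathProduct.rightHom a k

theorem wreath_pow_left_of_right_eq_one (a : D ≀ᵣ Q) (ha : a.right = 1) (k : ℕ) (x : Q) :
    (a ^ k).left x = a.left x ^ k := by
  induction k with
  | zero => simp
  | succ k ih =>
    rw [pow_succ, pow_succ, RegularWreathProduct.mul_left, Pi.mul_apply, ih, wreath_pow_right, ha]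
    simp

theorem map_wreath_pow_left (φ : D →* A) (a : D ≀ᵣ Q) (k : ℕ) (x : Q) :
    φ ((a ^ k).left x) = ∏ i ∈ Finset.range k, φ (a.left ((a.right ^ i)⁻¹ * x)) := by
  induction k with
  | zero => simp
  | succ k ih =>
    rw [pow_succ, RegularWreathProduct.mul_left, Pi.mul_apply, map_mul, ih, wreath_pow_right,
      Finset.prod_range_succ]

theorem wreath_pow_prime_right {p : ℕ} (hQ : Nat.card Q = p) (a : D ≀ᵣ Q) : (a ^ p).right = 1 := by
  rw [wreath_pow_right, ← hQ, pow_card_eq_one']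

theorem wreath_pow_sq_eq_one {p : ℕ} (hD : ∀ y : D, y ^ p ^ 2 = 1) (a : D ≀ᵣ Q)
    (ha : a.right = 1) : a ^ p ^ 2 = 1 := by
  ext1
  · funext x
    rw [wreath_pow_left_of_right_eq_one a ha, hD, RegularWreathProduct.one_left, Pi.one_apply]
  · rw [wreath_pow_right, ha, one_pow, RegularWreathProduct.one_right]

theorem wreath_pow_prime_pow_left {p : ℕ} (hQ : Nat.card Q = p) (a : D ≀ᵣ Q) (k : ℕ) (x : Q) :
    ((a ^ p) ^ k).left x = (a ^ p).left x ^ k :=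
  wreath_pow_left_of_right_eq_one _ (wreath_pow_prime_right hQ a) k x

theorem wreath_pow_prime_pow_right {p : ℕ} (hQ : Nat.card Q = p) (a : D ≀ᵣ Q) (k : ℕ) :
    ((a ^ p) ^ k).right = 1 := by
  rw [wreath_pow_right, wreath_pow_prime_right hQ, one_pow]

theorem wreath_pow_cube_eq_one {p : ℕ} (hQ : Nat.card Q = p) (hD : ∀ y : D, y ^ p ^ 2 = 1)
    (a : D ≀ᵣ Q) : a ^ p ^ 3 = 1 := by
  rw [pow_succ', pow_mul]
  exact wreath_pow_sq_eq_one hD _ (wreath_pow_prime_right hQ a)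

/-- An element of the base group commuting with an element outside of the base group has
conjugate coordinates. -/
theorem map_left_eq_of_commute {p : ℕ} [Fact p.Prime] (hQ : Nat.card Q = p) (φ : D →* A)
    (g d : D ≀ᵣ Q) (hg : g.right ≠ 1) (hd : d.right = 1) (h : Commute g d) (x : Q) :
    φ (d.left x) = φ (d.left 1) := by
  have hstep : ∀ x, φ (d.left (g.right⁻¹ * x)) = φ (d.left x) := by
    intro x
    have h1 := congrArg φ (congrFun (congrArg RegularWreathProduct.left h.eq) x)
    simpa [hd, mul_comm] using h1
  have hstep' : ∀ (k : ℕ), φ (d.left (g.right⁻¹ ^ k)) = φ (d.left 1) := by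
    intro k
    induction k with
    | zero => simp
    | succ k ih => rw [pow_succ', hstep, ih]
  obtain ⟨k, rfl⟩ := exists_pow_eq_of_card_prime hQ (inv_ne_one.mpr hg) x
  exact hstep' k

variable [Fintype Q]

/-- The homomorphism from a wreath product to a commutative group which multiplies the values of
the coordinates. -/
def prodHom (Q : Type*) [Group Q] [Fintype Q] (φ : D →* A) : D ≀ᵣ Q →* A where
  toFun a := ∏ x, φ (a.left x)
  map_one' := by simp
  map_mul' a b := by
    simp only [RegularWreathProduct.mul_left, Pi.mul_apply, map_mul, Finset.prod_mul_distrib]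
    congr 1
    exact Fintype.prod_equiv (Equiv.mulLeft a.right⁻¹) _ _ fun x => rfl

theorem prodHom_apply (φ : D →* A) (a : D ≀ᵣ Q) : prodHom Q φ a = ∏ x, φ (a.left x) := rfl

variable {p : ℕ} [Fact p.Prime]

/-- The coordinate is a product once around the `p`-cycle; its starting point `x` is lost in a
commutative target. -/
theorem map_wreath_pow_prime_left (hQ : Nat.card Q = p) (φ : D →* A) (a : D ≀ᵣ Q)
    (ha : a.right ≠ 1) (x : Q) : φ ((a ^ p).left x) = prodHom Q φ a := by
  rw [map_wreath_pow_left,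
    prod_range_pow_of_card_prime hQ ha (fun z => φ (a.left (z⁻¹ * x))), prodHom_apply]
  exact Fintype.prod_equiv ((Equiv.inv Q).trans (Equiv.mulRight x)) _ _ fun _ => rfl

section Power

variable (φ : D →* A) (ι : D →* B)

theorem wreath_pow_sq_eq (hQ : Nat.card Q = p) (hD : ∀ y : D, y ^ p ^ 2 = 1)
    (hpow : ∀ (n : ℕ) (y z : D), φ z = φ y ^ n → (ι z = 1 ↔ ι y = 1) → z ^ p = (y ^ p) ^ n)
    (n : ℕ) (a b : D ≀ᵣ Q) (h : prodHom Q φ b = prodHom Q φ a ^ n)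
    (h' : prodHom Q ι b = 1 ↔ prodHom Q ι a = 1) (hr : b.right = 1 ↔ a.right = 1) :
    b ^ p ^ 2 = (a ^ p ^ 2) ^ n := by
  by_cases ha : a.right = 1
  · rw [wreath_pow_sq_eq_one hD a ha, wreath_pow_sq_eq_one hD b (hr.mpr ha), one_pow]
  have hb : b.right ≠ 1 := hr.not.mpr ha
  rw [sq, pow_mul, pow_mul, ← pow_mul (a ^ p) p n]
  ext1
  · funext x
    rw [wreath_pow_prime_pow_left hQ, wreath_pow_prime_pow_left hQ, pow_mul]
    apply hpow
    · rw [map_wreath_pow_prime_left hQ φ a ha, map_wreath_pow_prime_left hQ φ b hb, h]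
    · rw [map_wreath_pow_prime_left hQ ι a ha, map_wreath_pow_prime_left hQ ι b hb, h']
  · rw [wreath_pow_prime_pow_right hQ, wreath_pow_prime_pow_right hQ]

theorem prodHom_eq_of_pow_sq_eq (hQ : Nat.card Q = p) (hD : ∀ y : D, y ^ p ^ 2 = 1)
    (hφ : ∀ y z : D, y ^ p = z ^ p → φ y = φ z) (a b : D ≀ᵣ Q) (h : a ^ p ^ 2 = b ^ p ^ 2)
    (h1 : a ^ p ^ 2 ≠ 1) : prodHom Q φ a = prodHom Q φ b := by
  have ha : a.right ≠ 1 := fun ha => h1 (wreath_pow_sq_eq_one hD a ha)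
  have hb : b.right ≠ 1 := fun hb => h1 (h.trans (wreath_pow_sq_eq_one hD b hb))
  rw [sq, pow_mul, pow_mul] at h
  have h2 := congrFun (congrArg RegularWreathProduct.left h) 1
  rw [wreath_pow_prime_pow_left hQ, wreath_pow_prime_pow_left hQ] at h2
  rw [← map_wreath_pow_prime_left hQ φ a ha 1, ← map_wreath_pow_prime_left hQ φ b hb 1]
  exact hφ _ _ h2

end Power

/-! ### Centralizers in the wreath product -/

section Centralizer

theorem prodHom_eq_one_of_commute (hQ : Nat.card Q = p) (hA : Nat.card A = p) (φ : D →* A)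
    (g d : D ≀ᵣ Q) (hg : g.right ≠ 1) (hd : d.right = 1) (h : Commute g d) :
    prodHom Q φ d = 1 := by
  rw [prodHom_apply, Finset.prod_congr rfl fun x _ => map_left_eq_of_commute hQ φ g d hg hd h x,
    Finset.prod_const, Finset.card_univ, ← Nat.card_eq_fintype_card, hQ, ← hA, pow_card_eq_one']

theorem prodHom_eq_pow_of_commute (hQ : Nat.card Q = p) (hA : Nat.card A = p) (φ : D →* A)
    (g u : D ≀ᵣ Q) (hg : g.right ≠ 1) (h : Commute g u) (k : ℕ) (hk : g.right ^ k = u.right) :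
    prodHom Q φ u = prodHom Q φ g ^ k := by
  have h1 : (u * (g ^ k)⁻¹).right = 1 := by
    rw [RegularWreathProduct.mul_right, RegularWreathProduct.inv_right, wreath_pow_right, hk,
      mul_inv_cancel]
  have h2 := prodHom_eq_one_of_commute hQ hA φ g (u * (g ^ k)⁻¹) hg h1
    (h.mul_right ((Commute.refl g).pow_right k).inv_right)
  rwa [map_mul, map_inv, map_pow, mul_inv_eq_one] at h2

/-- Inside the centralizer of an element outside of the base group, the three homomorphisms have
a common cyclic image. -/
theorem map_eq_one_of_commute (hQ : Nat.card Q = p) (hA : Nat.card A = p) (hB : Nat.card B = p)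
    (φ : D →* A) (ι : D →* B) (g a u : D ≀ᵣ Q) (hg : g.right ≠ 1) (ha : Commute g a)
    (hu : Commute g u) (hφa : prodHom Q φ a ≠ 1) (hφu : prodHom Q φ u = 1) :
    prodHom Q ι u = 1 ∧ u.right = 1 := by
  obtain ⟨i, hi⟩ := exists_pow_eq_of_card_prime hQ hg a.right
  obtain ⟨k, hk⟩ := exists_pow_eq_of_card_prime hQ hg u.right
  have h1 := prodHom_eq_pow_of_commute hQ hA φ g a hg ha i hi
  have h2 := prodHom_eq_pow_of_commute hQ hA φ g u hg hu k hk
  have hg1 : prodHom Q φ g ≠ 1 := fun h => hφa (by rw [h1, h, one_pow])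
  have hord : orderOf (prodHom Q φ g) = p :=
    orderOf_eq_prime (by rw [← hA, pow_card_eq_one']) hg1
  -- All three values at `u` are `k`-th powers of those at `g`, so `p ∣ k` kills them.
  obtain ⟨l, rfl⟩ : p ∣ k := hord ▸ orderOf_dvd_of_pow_eq_one (h2.symm.trans hφu)
  constructor
  · rw [prodHom_eq_pow_of_commute hQ hB ι g u hg hu _ hk, pow_mul, ← hB, pow_card_eq_one', one_pow]
  · rw [← hk, pow_mul, ← hQ, pow_card_eq_one', one_pow]

open Classical in
theorem prodHom_mulSingle (φ : D →* A) (x : Q) (d : D) :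
    prodHom Q φ ⟨Pi.mulSingle x d, 1⟩ = φ d := by
  rw [prodHom_apply, Fintype.prod_eq_single x fun y hy => by simp [Pi.mulSingle_eq_of_ne hy]]
  simp

/-- An element `a` outside of the base group that commutes with an element `g` of the base group
can be modified in one coordinate such that the product around the cycle becomes trivial. -/
theorem exists_commute_prodHom_eq_one (hQ : Nat.card Q = p) (φ : D →* A) (ι : D →* B)
    (g a : D ≀ᵣ Q) (hg : g.right = 1) (ha : a.right ≠ 1) (h : Commute g a) :
    ∃ w : D ≀ᵣ Q, Commute g w ∧ prodHom Q φ w = 1 ∧ prodHom Q ι w = 1 ∧ w.right ≠ 1 := by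
  classical
  have h1 : Commute (g.left 1) ((a ^ p).left 1) := by
    have h2 := congrFun (congrArg RegularWreathProduct.left (h.pow_right p).eq) 1
    simpa [hg, wreath_pow_prime_right hQ, commute_iff_eq] using h2
  -- The correcting coordinate commutes with `g.left 1` because `a ^ p` commutes with `g` and both
  -- lie in the base group.
  refine ⟨⟨Pi.mulSingle 1 ((a ^ p).left 1)⁻¹, 1⟩ * a, Commute.mul_right ?_ h, ?_, ?_, by simpa⟩
  · ext1
    · funext x
      rcases eq_or_ne x 1 with rfl | hx
      · simpa [hg] using h1.inv_right.eq
      · simp [hg, Pi.mulSingle_eq_of_ne hx]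
    · simp
  · rw [map_mul, prodHom_mulSingle, map_inv, map_wreath_pow_prime_left hQ φ a ha, inv_mul_cancel]
  · rw [map_mul, prodHom_mulSingle, map_inv, map_wreath_pow_prime_left hQ ι a ha, inv_mul_cancel]

end Centralizer

end Wreath

/-! ### Assembly -/

/-- A criterion for a wreath product with a group of order `p` to be `FSZ⁺`. -/
theorem isFSZPlus_wreath {D Q A B : Type*} [Group D] [Finite D] [CommGroup Q] [Finite Q]
    [CommGroup A] [CommGroup B] {p : ℕ} [Fact p.Prime] (hQ : Nat.card Q = p) (hA : Nat.card A = p)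
    (hB : Nat.card B = p) (φ : D →* A) (ι : D →* B) (hD : ∀ y : D, y ^ p ^ 2 = 1)
    (hpow : ∀ (n : ℕ) (y z : D), φ z = φ y ^ n → (ι z = 1 ↔ ι y = 1) → z ^ p = (y ^ p) ^ n)
    (hφ : ∀ y z : D, y ^ p = z ^ p → φ y = φ z) (t : ℕ) (ht : 1 < t) :
    IsFSZPlus (D ≀ᵣ Q) (p ^ t) := by
  have : Fintype Q := Fintype.ofFinite Q
  obtain ⟨s, rfl⟩ : ∃ s, t = s + 2 := ⟨t - 2, by omega⟩
  intro g
  have hcomm : ∀ a : Subgroup.centralizer {g}, Commute g a := fun a =>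
    Subgroup.mem_centralizer_singleton_iff.mp a.2 |>.symm
  have hpm : ∀ a : D ≀ᵣ Q, a ^ p ^ (s + 2) = (a ^ p ^ 2) ^ p ^ s := fun a => by
    rw [← pow_mul, ← pow_add, add_comm 2 s]
  have hsq : ∀ a : D ≀ᵣ Q, a ^ p ^ (s + 2) ≠ 1 → a ^ p ^ 2 ≠ 1 := fun a h h1 =>
    h (by rw [hpm, h1, one_pow])
  refine isFSZ_of_homs hA hB hQ ((prodHom Q φ).comp (Subgroup.subtype _))
    ((prodHom Q ι).comp (Subgroup.subtype _))
    (RegularWreathProduct.rightHom.comp (Subgroup.subtype _)) ?_ ?_ ?_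
  · intro n a b h1 h2 h3
    refine Subtype.ext ?_
    push_cast
    rw [hpm, hpm, wreath_pow_sq_eq φ ι hQ hD hpow n a b h1 h2 h3, pow_right_comm]
  · intro a b hab h1
    replace hab : (a : D ≀ᵣ Q) ^ p ^ (s + 2) = (b : D ≀ᵣ Q) ^ p ^ (s + 2) := by
      simpa using congrArg Subtype.val hab
    replace h1 : (a : D ≀ᵣ Q) ^ p ^ (s + 2) ≠ 1 := fun h => h1 (Subtype.ext (by simpa using h))
    -- Only `t = 2` has content here: all `p ^ 3`-th powers are trivial.
    rcases s with _ | s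
    · exact prodHom_eq_of_pow_sq_eq φ hQ hD hφ a b hab h1
    · refine absurd ?_ h1
      rw [show s + 1 + 2 = 3 + s by omega, pow_add, pow_mul, wreath_pow_cube_eq_one hQ hD, one_pow]
  · intro a ha
    have h1 : (a : D ≀ᵣ Q) ^ p ^ 2 ≠ 1 := hsq _ fun h => ha (Subtype.ext (by simpa using h))
    have har : (a : D ≀ᵣ Q).right ≠ 1 := fun h => h1 (wreath_pow_sq_eq_one hD _ h)
    by_cases hg : g.right = 1
    · obtain ⟨w, hw, hw'⟩ := exists_commute_prodHom_eq_one hQ φ ι g a hg har (hcomm a)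
      exact Or.inl ⟨⟨w, Subgroup.mem_centralizer_singleton_iff.mpr hw.eq.symm⟩, hw'⟩
    · refine Or.inr fun u hu =>
        map_eq_one_of_commute hQ hA hB φ ι g a u hg (hcomm a) (hcomm u) (fun h => h1 ?_) hu
      simpa using wreath_pow_sq_eq φ ι hQ hD hpow 0 a a (by simpa using h) Iff.rfl Iff.rfl

end FSZ

theorem mainTheorem8 (p : ℕ) [Fact p.Prime] (t : ℕ) (ht : 1 < t) :
    FSZ.IsFSZPlus (FSZ.FGroup p 1 ≀ᵣ Multiplicative (ZMod p)) (p ^ t) := by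
  have hcard : Nat.card (Multiplicative (ZMod p)) = p :=
    (Nat.card_congr Multiplicative.toAdd).trans (Nat.card_zmod p)
  let _ : CommGroup (Subgroup.zpowers (FSZ.bAut p 1)) :=
    { mul_comm := (Subgroup.zpowers_isMulCommutative (FSZ.bAut p 1)).is_comm.comm }
  exact FSZ.isFSZPlus_wreath hcard hcard (FSZ.card_zpowers_bAut p) (FSZ.expHom p)
    SemidirectProduct.rightHom (FSZ.pow_prime_sq_eq_one p) (FSZ.pow_prime_eq p)
    (FSZ.expHom_eq_of_pow_prime_eq p) t ht
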